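/- Let $V=\{1,\dots,p\}$ and let $F:2^V\to\mathbb{R}$ be non-negative and submodular with $F(\varnothing)=F(V)=0$. Let $f(w)=\int_{\mathbb{R}}F(\{w\ge\alpha\})\,d\alpha$ be its Lovász extension and $B(F)=\{s\in\mathbb{R}^p:\ s(A)\le F(A)\ \forall A\subset V,\ s(V)=F(V)\}$ its base polyhedron, where $s(A)=\sum_{k\in A}s_k$. A set $A$ is called separable for a set-function $G$ if $A$ is the disjoint union of two non-empty sets $B,C$ with $G(A)=G(B)+G(C)$, and inseparable otherwise. For $w\in\mathbb{R}^p$, the lattice $\mathcal{D}(w)$ associated to $w$ consists of the sets $A$ such that $s(A)=F(A)$ for every $s$ in the face $\operatorname{argmax}_{s\in B(F)}w^\top s$. The constant sets of $w$ are the elements of the partition of $V$ defined by $\mathcal{D}(w)$: two indices $i,j$ are in the same constant set if and only if every $A\in\mathcal{D}(w)$ contains both or neither of them. (The variable $w$ takes a single value on each of them.) Suppose that for all $A,B\subset V$ with $A\cap B=\varnothing$ and $A$ inseparable for $D\mapsto F(B\cup D)-F(B)$, $$\forall C\subset A,\qquad \frac{|C|}{|A|}\,[F(B\cup A)-F(B)]\le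 F(B\cup C)-F(B).$$ Let $z\in\mathbb{R}^p$. Then for every $\lambda\ge 0$ the proximal problem $\min_{w\in\mathbb{R}^p}\frac12\|w-z\|_2^2+\lambda f(w)$ has a unique solution $w^\lambda$, and the regularization path $\lambda\mapsto w^\lambda$ is agglomerative: if two variables are in the same constant set of $w^\mu$ for some $\mu\ge 0$, then for all $\lambda\ge\mu$ they are in the same constant set of $w^\lambda$, and in particular $w^\lambda_i=w^\lambda_j$. The same conclusion holds for any two variables in a set $\{w^\mu=\alpha\}$ that is inseparable for $D\mapsto F(\{w^\mu>\alpha\}\cup D)-F(\{w^\mu>\alpha\})$. -/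

import Mathlib

/-- `F(A) + F(B) ≥ F(A ∪ B) + F(A ∩ B)` for all subsets `A`, `B` of the ground set. -/
def IsSubmodular {p : ℕ} (F : Finset (Fin p) → ℝ) : Prop :=
  ∀ A B : Finset (Fin p), F (A ∪ B) + F (A ∩ B) ≤ F A + F B

/-- `A` is separable for `G` if `A = B ∪ C` is a partition into two nonempty sets with
`G A = G B + G C`. -/
def IsSeparableSet {p : ℕ} (G : Finset (Fin p) → ℝ) (A : Finset (Fin p)) : Prop :=
  ∃ B C : Finset (Fin p), B.Nonempty ∧ C.Nonempty ∧ Disjoint B C ∧ B ∪ C = A ∧ G A = G B + G C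

/-- The set-function `D ↦ F(B ∪ D) - F(B)`. -/
def contraction {p : ℕ} (F : Finset (Fin p) → ℝ) (B : Finset (Fin p)) : Finset (Fin p) → ℝ :=
  fun D => F (B ∪ D) - F B

/-- The level set `{w ≥ α}`. -/
noncomputable def levelSet {p : ℕ} (w : EuclideanSpace ℝ (Fin p)) (α : ℝ) : Finset (Fin p) :=
  Finset.univ.filter (fun k => α ≤ w k)

/-- The set `{w > α}`. -/
noncomputable def strictLevelSet {p : ℕ} (w : EuclideanSpace ℝ (Fin p)) (α : ℝ) :
    Finset (Fin p) :=
  Finset.univ.filter (fun k => α < w k)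

/-- The set `{w = α}`. -/
noncomputable def valueSet {p : ℕ} (w : EuclideanSpace ℝ (Fin p)) (α : ℝ) : Finset (Fin p) :=
  Finset.univ.filter (fun k => w k = α)

/-- The Lovász extension `f(w) = ∫ F({w ≥ α}) dα`. When `F ∅ = F V = 0` the integrand is a
step function with bounded support. -/
noncomputable def lovasz {p : ℕ} (F : Finset (Fin p) → ℝ) (w : EuclideanSpace ℝ (Fin p)) : ℝ :=
  ∫ α : ℝ, F (levelSet w α)

/-- The base polyhedron `B(F)`. -/
def basePolyhedron {p : ℕ} (F : Finset (Fin p) → ℝ) : Set (EuclideanSpace ℝ (Fin p)) :=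
  {s | (∀ A : Finset (Fin p), ∑ k ∈ A, s k ≤ F A) ∧ ∑ k, s k = F Finset.univ}

/-- The face of `B(F)` exposed by `w`: the maximizers of `s ↦ wᵀ s` over `B(F)`. It is polar to the
face of `{f ≤ 1}` whose relative interior contains the positive multiple of `w` with `f = 1`. -/
def exposedFace {p : ℕ} (F : Finset (Fin p) → ℝ) (w : EuclideanSpace ℝ (Fin p)) :
    Set (EuclideanSpace ℝ (Fin p)) :=
  {s | s ∈ basePolyhedron F ∧ ∀ t ∈ basePolyhedron F, ∑ k, w k * t k ≤ ∑ k, w k * s k}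

/-- The lattice associated to `w`: the sets that are tight on the whole face exposed by `w`. -/
def assocLattice {p : ℕ} (F : Finset (Fin p) → ℝ) (w : EuclideanSpace ℝ (Fin p)) :
    Set (Finset (Fin p)) :=
  {A | ∀ s ∈ exposedFace F w, ∑ k ∈ A, s k = F A}

/-- `i` and `j` are in the same element of the partition of the ground set given by the lattice
associated to `w`: no set of the lattice contains one of them and not the other. -/
def SameConstantSet {p : ℕ} (F : Finset (Fin p) → ℝ) (w : EuclideanSpace ℝ (Fin p))
    (i j : Fin p) : Prop :=
  ∀ A ∈ assocLattice F w, (i ∈ A ↔ j ∈ A)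

/-- `w` minimizes `½ ‖w - z‖² + lam * f(w)` over `ℝᵖ`. -/
def IsProxSolution {p : ℕ} (F : Finset (Fin p) → ℝ) (z : EuclideanSpace ℝ (Fin p)) (lam : ℝ)
    (w : EuclideanSpace ℝ (Fin p)) : Prop :=
  ∀ v : EuclideanSpace ℝ (Fin p),
    1 / 2 * ‖w - z‖ ^ 2 + lam * lovasz F w ≤ 1 / 2 * ‖v - z‖ ^ 2 + lam * lovasz F v

/-!
The face of `B(F)` exposed by `w` is the subdifferential of the Lovász extension at `w`, and by the
greedy algorithm it consists of the points of `B(F)` that are tight on all superlevel sets of `w`.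
Hence `w` solves the proximal problem exactly when `z - w` lies in `lam` times this face, and
constant sets can only merge when the face grows; so it suffices that the faces increase along the
path.

Averaging a point of the face of `w` over the constant sets of `w` gives a point `x` that satisfies
the constraints of `B(F)`, hence is still in the face: this is where the hypothesis on inseparable
sets enters, since the blocks of a maximal chain in the lattice of `w` are inseparable. As `x` is
constant on the constant sets of `w`, the face of `w - t • x` contains the face of `w` for small
`t`. So `w - t • x` solves the problem started at `w` with parameter `t`, and, as the face is
convex, it also continues the path through `w`. The path is continuous, so this local monotonicity
of the faces propagates to all larger parameters.
-/

open Filter MeasureTheory Set Topology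

section Superlevel

variable {ι L : Type*}

/-- `U` is `∅` or a superlevel set `{r ≥ a}`, phrased as closure of `U` under passing to larger
values of `r`. -/
def IsSuperlevelSet [LE L] (r : ι → L) (U : Finset ι) : Prop :=
  ∀ ⦃i j⦄, r i ≤ r j → i ∈ U → j ∈ U

theorem isSuperlevelSet_univ [Fintype ι] [LE L] (r : ι → L) : IsSuperlevelSet r Finset.univ :=
  fun _ j _ _ => Finset.mem_univ j

theorem IsSuperlevelSet.of_le_imp_le {L' : Type*} [LE L] [LE L'] {r : ι → L} {r' : ι → L'}
    {U : Finset ι} (hU : IsSuperlevelSet r U) (h : ∀ i j, r' i ≤ r' j → r i ≤ r j) :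
    IsSuperlevelSet r' U :=
  fun i j hij => hU (h i j hij)

end Superlevel

section Greedy

variable {p : ℕ} {F : Finset (Fin p) → ℝ} {L : Type*} [LinearOrder L] {r : Fin p → L}

/-- The output of the greedy algorithm: the vector of marginal values of `F` when the elements are
added one at a time in decreasing order of `r`. It is meaningful when `r` is injective. -/
def greedyBase (F : Finset (Fin p) → ℝ) (r : Fin p → L) : EuclideanSpace ℝ (Fin p) :=
  WithLp.toLp 2 fun k =>
    F (Finset.univ.filter fun j => r k ≤ r j) - F (Finset.univ.filter fun j => r k < r j)

theorem sum_greedyBase_le (hsub : IsSubmodular F) (hempty : F ∅ = 0) (hr : Function.Injective r)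
    (A : Finset (Fin p)) : ∑ k ∈ A, greedyBase F r k ≤ F A := by
  induction A using Finset.induction_on_min_value r with
  | empty => simp [hempty]
  | insert k B hk hmin ih =>
    have hlt : ∀ j ∈ B, r k < r j := fun j hj =>
      (hmin j hj).lt_of_ne (hr.ne (ne_of_mem_of_not_mem hj hk).symm)
    have hunion : insert k B ∪ Finset.univ.filter (fun j => r k < r j) =
        Finset.univ.filter fun j => r k ≤ r j := by
      ext j
      have := hr.eq_iff (a := k) (b := j)
      grind
    have hinter : insert k B ∩ Finset.univ.filter (fun j => r k < r j) = B := by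
      grind
    have hFk := hsub (insert k B) (Finset.univ.filter fun j => r k < r j)
    rw [hunion, hinter] at hFk
    have hmarginal : greedyBase F r k = F (Finset.univ.filter fun j => r k ≤ r j) -
        F (Finset.univ.filter fun j => r k < r j) := rfl
    rw [Finset.sum_insert hk]
    linarith

theorem sum_greedyBase (hempty : F ∅ = 0) (hr : Function.Injective r) {U : Finset (Fin p)}
    (hU : IsSuperlevelSet r U) : ∑ k ∈ U, greedyBase F r k = F U := by
  induction U using Finset.induction_on_min_value r with
  | empty => simp [hempty]
  | insert k B hk hmin ih =>
    have hmem : ∀ j, r k ≤ r j ↔ j ∈ insert k B := fun j =>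
      ⟨fun h => hU h (Finset.mem_insert_self k B), fun h => by
        rcases Finset.mem_insert.1 h with rfl | h
        exacts [le_rfl, hmin j h]⟩
    have hB : ∀ j, r k < r j ↔ j ∈ B := fun j => by
      have := hr.eq_iff (a := k) (b := j)
      grind
    have hBup : IsSuperlevelSet r B := fun i j hij hi =>
      (hB j).1 (((hB i).2 hi).trans_le hij)
    rw [Finset.sum_insert hk, ih hBup, greedyBase]
    simp only [hmem, hB, Finset.filter_univ_mem, sub_add_cancel]

theorem exists_mem_basePolyhedron_sum_eq (hsub : IsSubmodular F) (hempty : F ∅ = 0)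
    (r : Fin p → L) :
    ∃ s ∈ basePolyhedron F, ∀ U, IsSuperlevelSet r U → ∑ k ∈ U, s k = F U := by
  let q : Fin p → L ×ₗ Fin p := fun k => toLex (r k, k)
  have hq : Function.Injective q := fun a b h => (Prod.ext_iff.1 (toLex.injective h)).2
  exact ⟨greedyBase F q,
    ⟨sum_greedyBase_le hsub hempty hq, sum_greedyBase hempty hq (isSuperlevelSet_univ q)⟩,
    fun U hU => sum_greedyBase hempty hq
      (hU.of_le_imp_le fun i j hij => Prod.Lex.monotone_fst _ _ hij)⟩

end Greedy

section LayerCake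

variable {p : ℕ} {w d : EuclideanSpace ℝ (Fin p)}

theorem isSuperlevelSet_levelSet (w : EuclideanSpace ℝ (Fin p)) (α : ℝ) :
    IsSuperlevelSet w (levelSet w α) := fun i j hij hi => by
  simp only [levelSet, Finset.mem_filter, Finset.mem_univ, true_and] at hi ⊢
  exact hi.trans hij

theorem isSuperlevelSet_strictLevelSet (w : EuclideanSpace ℝ (Fin p)) (α : ℝ) :
    IsSuperlevelSet w (strictLevelSet w α) := fun i j hij hi => by
  simp only [strictLevelSet, Finset.mem_filter, Finset.mem_univ, true_and] at hi ⊢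
  exact hi.trans_le hij

theorem IsSuperlevelSet.frequently_levelSet_eq {U : Finset (Fin p)} (hU : IsSuperlevelSet w U)
    (hne : U.Nonempty) : ∃ᶠ α in ae volume, levelSet w α = U := by
  obtain ⟨k, hk, hmin⟩ := Finset.exists_min_image U w hne
  have hlt : ∀ j ∉ U, w j < w k := fun j hj => lt_of_not_ge fun h => hj (hU h hk)
  obtain ⟨a, hak, ha⟩ : ∃ a < w k, ∀ j ∉ U, w j ≤ a := by
    have hbelow : ∀ᶠ a in 𝓝[<] w k, ∀ j ∉ U, w j ≤ a := by
      simp only [eventually_all]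
      intro j hj
      filter_upwards [Ioo_mem_nhdsLT (hlt j hj)] with a ha using ha.1.le
    exact (eventually_mem_nhdsWithin.and hbelow).exists
  have hIoo : Ioo a (w k) ⊆ {α | levelSet w α = U} := fun α hα => by
    ext j
    simp only [levelSet, Finset.mem_filter, Finset.mem_univ, true_and]
    refine ⟨fun h => ?_, fun h => hα.2.le.trans (hmin j h)⟩
    by_contra hj
    exact (hα.1.trans_le h).not_ge (ha j hj)
  rw [frequently_ae_iff]
  exact (measure_pos_of_superset hIoo (by simpa using hak)).ne'

theorem sum_levelSet_eq_sum_indicator (hd : ∑ k, d k = 0) {m : ℝ} (hm : ∀ k, m ≤ w k) (α : ℝ) :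
    ∑ k ∈ levelSet w α, d k = ∑ k, (Ioc m (w k)).indicator (fun _ => d k) α := by
  by_cases hα : m < α
  · simp [levelSet, Finset.sum_filter, indicator_apply, hα]
  · have hall : levelSet w α = Finset.univ := by
      simpa [levelSet, Finset.filter_eq_self] using fun k => (not_lt.1 hα).trans (hm k)
    simp [hall, hd, hα]

theorem integrable_sum_levelSet (w : EuclideanSpace ℝ (Fin p)) (hd : ∑ k, d k = 0) :
    Integrable fun α : ℝ => ∑ k ∈ levelSet w α, d k := by
  obtain ⟨m, hm⟩ := (finite_range w).bddBelow
  simp only [sum_levelSet_eq_sum_indicator hd fun k => hm (mem_range_self k)]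
  exact integrable_finsetSum _ fun k _ =>
    (integrable_indicator_iff measurableSet_Ioc).2 (integrableOn_const (by simp))

theorem integral_sum_levelSet (w : EuclideanSpace ℝ (Fin p)) (hd : ∑ k, d k = 0) :
    ∫ α : ℝ, ∑ k ∈ levelSet w α, d k = ∑ k, w k * d k := by
  obtain ⟨m, hm⟩ := (finite_range w).bddBelow
  replace hm : ∀ k, m ≤ w k := fun k => hm (mem_range_self k)
  have hlayer : ∀ k, ∫ α, (Ioc m (w k)).indicator (fun _ => d k) α = (w k - m) * d k := fun k => by
    rw [integral_indicator measurableSet_Ioc, setIntegral_const, Real.volume_real_Ioc_of_le (hm k),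
      smul_eq_mul]
  simp only [sum_levelSet_eq_sum_indicator hd hm]
  rw [integral_finsetSum _ fun k _ =>
    (integrable_indicator_iff measurableSet_Ioc).2 (integrableOn_const (by simp))]
  simp only [hlayer, sub_mul, Finset.sum_sub_distrib, ← Finset.mul_sum, hd, mul_zero, sub_zero]

theorem sum_mul_le_sum_mul_of_sum_levelSet_le {s t : EuclideanSpace ℝ (Fin p)}
    (hst : ∑ k, s k = ∑ k, t k)
    (hle : ∀ α, ∑ k ∈ levelSet w α, s k ≤ ∑ k ∈ levelSet w α, t k) :
    ∑ k, w k * s k ≤ ∑ k, w k * t k := by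
  have hd : ∑ k, (t - s) k = 0 := by simp [hst]
  have hnonneg : 0 ≤ ∑ k, w k * (t - s) k := by
    rw [← integral_sum_levelSet w hd]
    exact integral_nonneg fun α => by simpa using hle α
  simpa [mul_sub] using hnonneg

theorem IsSuperlevelSet.sum_eq_sum_of_sum_mul_eq {s t : EuclideanSpace ℝ (Fin p)}
    {U : Finset (Fin p)} (hU : IsSuperlevelSet w U) (hst : ∑ k, s k = ∑ k, t k)
    (hle : ∀ α, ∑ k ∈ levelSet w α, s k ≤ ∑ k ∈ levelSet w α, t k)
    (hw : ∑ k, w k * s k = ∑ k, w k * t k) : ∑ k ∈ U, s k = ∑ k ∈ U, t k := by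
  rcases U.eq_empty_or_nonempty with rfl | hne
  · simp
  have hd : ∑ k, (t - s) k = 0 := by simp [hst]
  have hint : ∫ α, ∑ k ∈ levelSet w α, (t - s) k = 0 := by
    rw [integral_sum_levelSet w hd]
    simp [mul_sub, hw]
  have hae := (integral_eq_zero_iff_of_nonneg (fun α => by simpa using hle α)
    (integrable_sum_levelSet w hd)).1 hint
  obtain ⟨α, rfl, hα⟩ := ((hU.frequently_levelSet_eq hne).and_eventually hae).exists
  exact (sub_eq_zero.1 (by simpa using hα)).symm

end LayerCake

section ExposedFace

variable {p : ℕ} {F : Finset (Fin p) → ℝ} {w s : EuclideanSpace ℝ (Fin p)}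

theorem mem_exposedFace_iff_sum_eq (hsub : IsSubmodular F) (hempty : F ∅ = 0) :
    s ∈ exposedFace F w ↔
      s ∈ basePolyhedron F ∧ ∀ U, IsSuperlevelSet w U → ∑ k ∈ U, s k = F U := by
  have hle : ∀ {t g : EuclideanSpace ℝ (Fin p)}, t ∈ basePolyhedron F →
      (∀ U, IsSuperlevelSet w U → ∑ k ∈ U, g k = F U) →
      ∀ α, ∑ k ∈ levelSet w α, t k ≤ ∑ k ∈ levelSet w α, g k := fun ht hgU α =>
    (ht.1 _).trans (hgU _ (isSuperlevelSet_levelSet w α)).ge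
  constructor
  · rintro ⟨hs, hmax⟩
    obtain ⟨g, hg, hgU⟩ := exists_mem_basePolyhedron_sum_eq hsub hempty w
    have hsum := hs.2.trans hg.2.symm
    have hw := (sum_mul_le_sum_mul_of_sum_levelSet_le hsum (hle hs hgU)).antisymm (hmax g hg)
    exact ⟨hs, fun U hU =>
      (hU.sum_eq_sum_of_sum_mul_eq hsum (hle hs hgU) hw).trans (hgU U hU)⟩
  · rintro ⟨hs, hsU⟩
    exact ⟨hs, fun t ht =>
      sum_mul_le_sum_mul_of_sum_levelSet_le (ht.2.trans hs.2.symm) (hle ht hsU)⟩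

theorem exposedFace_nonempty (hsub : IsSubmodular F) (hempty : F ∅ = 0)
    (w : EuclideanSpace ℝ (Fin p)) : (exposedFace F w).Nonempty := by
  obtain ⟨s, hs⟩ := exists_mem_basePolyhedron_sum_eq hsub hempty w
  exact ⟨s, (mem_exposedFace_iff_sum_eq hsub hempty).2 hs⟩

theorem exposedFace_subset_of_lt_imp_lt (hsub : IsSubmodular F) (hempty : F ∅ = 0)
    {v : EuclideanSpace ℝ (Fin p)} (h : ∀ i j, w j < w i → v j < v i) :
    exposedFace F v ⊆ exposedFace F w := fun s hs => by
  rw [mem_exposedFace_iff_sum_eq hsub hempty] at hs ⊢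
  exact ⟨hs.1, fun U hU => hs.2 U (hU.of_le_imp_le fun i j hij =>
    not_lt.1 fun hji => (h i j hji).not_ge hij)⟩

theorem eventually_exposedFace_subset (hsub : IsSubmodular F) (hempty : F ∅ = 0)
    (w : EuclideanSpace ℝ (Fin p)) : ∀ᶠ v in 𝓝 w, exposedFace F v ⊆ exposedFace F w := by
  have hcoord : ∀ k, Continuous fun v : EuclideanSpace ℝ (Fin p) => v k := fun k => by fun_prop
  have horder : ∀ᶠ v in 𝓝 w, ∀ i j, w j < w i → v j < v i := by
    simp only [eventually_all]
    exact fun i j hij => (hcoord j).continuousAt.eventually_lt (hcoord i).continuousAt hij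
  exact horder.mono fun v => exposedFace_subset_of_lt_imp_lt hsub hempty

theorem inner_eq_sum_mul (w s : EuclideanSpace ℝ (Fin p)) : inner ℝ w s = ∑ k, w k * s k := by
  simp [PiLp.inner_apply, mul_comm]

theorem mem_exposedFace_iff_inner_le :
    s ∈ exposedFace F w ↔
      s ∈ basePolyhedron F ∧ ∀ t ∈ basePolyhedron F, inner ℝ w t ≤ inner ℝ w s := by
  simp only [inner_eq_sum_mul]
  rfl

theorem inner_sub_sub_nonneg_of_mem_exposedFace {w' s' : EuclideanSpace ℝ (Fin p)}
    (hs : s ∈ exposedFace F w) (hs' : s' ∈ exposedFace F w') :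
    0 ≤ inner ℝ (w - w') (s - s') := by
  rw [mem_exposedFace_iff_inner_le] at hs hs'
  have hw := hs.2 s' hs'.1
  have hw' := hs'.2 s hs.1
  simp only [inner_sub_left, inner_sub_right]
  linarith

theorem isClosed_setOf_subset_exposedFace (F : Finset (Fin p) → ℝ)
    (S : Set (EuclideanSpace ℝ (Fin p))) : IsClosed {w | S ⊆ exposedFace F w} := by
  simp only [subset_def, mem_exposedFace_iff_inner_le, ofPred_forall, ofPred_and]
  exact isClosed_iInter fun s => isClosed_iInter fun _ => isClosed_const.inter <|
    isClosed_iInter fun t => isClosed_iInter fun _ => isClosed_le (by fun_prop) (by fun_prop)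

theorem isClosed_basePolyhedron (F : Finset (Fin p) → ℝ) : IsClosed (basePolyhedron F) := by
  simp only [basePolyhedron, ofPred_and, ofPred_forall]
  exact (isClosed_iInter fun A => isClosed_le (by fun_prop) continuous_const).inter
    (isClosed_eq (by fun_prop) continuous_const)

theorem convex_basePolyhedron (F : Finset (Fin p) → ℝ) : Convex ℝ (basePolyhedron F) := by
  have hlin : ∀ A : Finset (Fin p),
      IsLinearMap ℝ fun s : EuclideanSpace ℝ (Fin p) => ∑ k ∈ A, s k := fun A =>
    ⟨fun s t => by simp [Finset.sum_add_distrib], fun c s => by simp [Finset.mul_sum]⟩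
  simp only [basePolyhedron, ofPred_and, ofPred_forall]
  exact (convex_iInter fun A => convex_halfSpace_le (hlin A) _).inter
    (convex_hyperplane (hlin Finset.univ) _)

theorem convex_exposedFace (F : Finset (Fin p) → ℝ) (w : EuclideanSpace ℝ (Fin p)) :
    Convex ℝ (exposedFace F w) := by
  have hexp : exposedFace F w = (innerSL ℝ w).toExposed (basePolyhedron F) := by
    ext s
    simp [mem_exposedFace_iff_inner_le, ContinuousLinearMap.toExposed]
  rw [hexp]
  exact ContinuousLinearMap.toExposed.isExposed.convex (convex_basePolyhedron F)

theorem lovasz_eq_inner (hsub : IsSubmodular F) (hempty : F ∅ = 0) (huniv : F Finset.univ = 0)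
    (hs : s ∈ exposedFace F w) : lovasz F w = inner ℝ w s := by
  rw [inner_eq_sum_mul, ← integral_sum_levelSet w (hs.1.2.trans huniv), lovasz]
  congr 1 with α
  exact (((mem_exposedFace_iff_sum_eq hsub hempty).1 hs).2 _ (isSuperlevelSet_levelSet w α)).symm

theorem inner_le_lovasz (hsub : IsSubmodular F) (hempty : F ∅ = 0) (huniv : F Finset.univ = 0)
    (w : EuclideanSpace ℝ (Fin p)) (hs : s ∈ basePolyhedron F) : inner ℝ w s ≤ lovasz F w := by
  obtain ⟨g, hg⟩ := exposedFace_nonempty hsub hempty w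
  rw [lovasz_eq_inner hsub hempty huniv hg]
  exact (mem_exposedFace_iff_inner_le.1 hg).2 s hs

end ExposedFace

section Prox

variable {p : ℕ} {F : Finset (Fin p) → ℝ} {z u v w s : EuclideanSpace ℝ (Fin p)} {lam mu : ℝ}

/-- The optimality condition `z - w ∈ lam • ∂f(w)` of the proximal problem: the subdifferential of
the Lovász extension at `w` is the face of `B(F)` exposed by `w`. -/
def IsProxStationary (F : Finset (Fin p) → ℝ) (z : EuclideanSpace ℝ (Fin p)) (lam : ℝ)
    (w : EuclideanSpace ℝ (Fin p)) : Prop :=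
  ∃ s ∈ exposedFace F w, w = z - lam • s

theorem norm_sub_le_of_isProxStationary (hs : s ∈ exposedFace F (z - lam • s)) (hmu : 0 ≤ mu)
    (hv : IsProxStationary F z mu v) : ‖v - (z - lam • s)‖ ≤ |mu - lam| * ‖s‖ := by
  obtain ⟨t, ht, hvt⟩ := hv
  set w := z - lam • s with hw
  have hdiff : v - w = mu • (s - t) - (mu - lam) • s := by rw [hvt, hw]; module
  have hmono : inner ℝ (v - w) (s - t) ≤ 0 := by
    rw [← neg_sub t s, inner_neg_right]
    exact neg_nonpos.2 (inner_sub_sub_nonneg_of_mem_exposedFace ht hs)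
  have hsq : ‖v - w‖ * ‖v - w‖ ≤ |mu - lam| * ‖s‖ * ‖v - w‖ := calc
    ‖v - w‖ * ‖v - w‖ = inner ℝ (v - w) (mu • (s - t) - (mu - lam) • s) := by
      rw [← hdiff, real_inner_self_eq_norm_mul_norm]
    _ = mu * inner ℝ (v - w) (s - t) - inner ℝ (v - w) ((mu - lam) • s) := by
      rw [inner_sub_right, real_inner_smul_right]
    _ ≤ |inner ℝ (v - w) ((mu - lam) • s)| := by
      linarith [mul_nonpos_of_nonneg_of_nonpos hmu hmono,
        neg_abs_le (inner ℝ (v - w) ((mu - lam) • s))]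
    _ ≤ ‖v - w‖ * ‖(mu - lam) • s‖ := abs_real_inner_le_norm _ _
    _ = |mu - lam| * ‖s‖ * ‖v - w‖ := by rw [norm_smul, Real.norm_eq_abs]; ring
  rcases (norm_nonneg (v - w)).eq_or_lt with hzero | hpos
  · rw [← hzero]; positivity
  · exact le_of_mul_le_mul_right hsq hpos

theorem IsProxStationary.unique (hlam : 0 ≤ lam) (hv : IsProxStationary F z lam v)
    (hw : IsProxStationary F z lam w) : v = w := by
  obtain ⟨s, hs, rfl⟩ := hw
  have hle := norm_sub_le_of_isProxStationary hs hlam hv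
  rw [sub_self, abs_zero, zero_mul] at hle
  exact sub_eq_zero.1 (norm_le_zero_iff.1 hle)

theorem continuousOn_of_isProxStationary {x : ℝ → EuclideanSpace ℝ (Fin p)}
    (hx : ∀ l, 0 ≤ l → IsProxStationary F z l (x l)) : ContinuousOn x (Ici 0) := by
  intro l hl
  obtain ⟨s, hs, hxl⟩ := hx l hl
  have hbound : Tendsto (fun l' => |l' - l| * ‖s‖) (𝓝[Ici 0] l) (𝓝 0) := by
    have hcont : Continuous fun l' : ℝ => |l' - l| * ‖s‖ := by fun_prop
    simpa using (hcont.tendsto l).mono_left nhdsWithin_le_nhds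
  refine tendsto_iff_norm_sub_tendsto_zero.2 (squeeze_zero' (.of_forall fun _ => norm_nonneg _) ?_
    hbound)
  filter_upwards [self_mem_nhdsWithin] with l' hl'
  rw [hxl] at hs ⊢
  exact norm_sub_le_of_isProxStationary hs hl' (hx l' hl')

theorem IsProxStationary.trans (hlam : 0 ≤ lam) (hmu : 0 ≤ mu) (hu : IsProxStationary F z lam u)
    (hv : IsProxStationary F u mu v) (huv : exposedFace F u ⊆ exposedFace F v) :
    IsProxStationary F z (lam + mu) v := by
  obtain ⟨s, hs, hus⟩ := hu
  obtain ⟨t, ht, hvt⟩ := hv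
  obtain ⟨y, hy, hyst⟩ := (convex_exposedFace F v).exists_mem_add_smul_eq (huv hs) ht hlam hmu
  exact ⟨y, hy, by rw [hyst, hvt, hus]; abel⟩

-- `z - w` is `lam` times the projection of `lam⁻¹ • z` onto the base polyhedron.
theorem exists_isProxStationary (hsub : IsSubmodular F) (hempty : F ∅ = 0)
    (z : EuclideanSpace ℝ (Fin p)) (hlam : 0 ≤ lam) : ∃ w, IsProxStationary F z lam w := by
  obtain ⟨g, hg⟩ := exposedFace_nonempty hsub hempty z
  rcases hlam.eq_or_lt with rfl | hpos
  · exact ⟨z, g, hg, by simp⟩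
  have hconv := convex_basePolyhedron F
  obtain ⟨s, hs, hproj⟩ := exists_norm_eq_iInf_of_complete_convex ⟨g, hg.1⟩
    (isClosed_basePolyhedron F).isComplete hconv (lam⁻¹ • z)
  rw [norm_eq_iInf_iff_real_inner_le_zero hconv hs] at hproj
  refine ⟨z - lam • s, s, mem_exposedFace_iff_inner_le.2 ⟨hs, fun t ht => ?_⟩, rfl⟩
  have hscale : z - lam • s = lam • (lam⁻¹ • z - s) := by rw [smul_sub, smul_inv_smul₀ hpos.ne']
  rw [← sub_nonpos, ← inner_sub_right, hscale, real_inner_smul_left]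
  exact mul_nonpos_of_nonneg_of_nonpos hlam (hproj t ht)

theorem IsProxStationary.add_norm_sq_le (hsub : IsSubmodular F) (hempty : F ∅ = 0)
    (huniv : F Finset.univ = 0) (hlam : 0 ≤ lam) (hw : IsProxStationary F z lam w)
    (v : EuclideanSpace ℝ (Fin p)) :
    1 / 2 * ‖w - z‖ ^ 2 + lam * lovasz F w + 1 / 2 * ‖v - w‖ ^ 2 ≤
      1 / 2 * ‖v - z‖ ^ 2 + lam * lovasz F v := by
  obtain ⟨s, hs, hws⟩ := hw
  have hsubgrad : lam * inner ℝ v s ≤ lam * lovasz F v :=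
    mul_le_mul_of_nonneg_left (inner_le_lovasz hsub hempty huniv v hs.1) hlam
  have hcross : inner ℝ (v - w) (w - z) = lam * inner ℝ w s - lam * inner ℝ v s := by
    rw [show w - z = -(lam • s) by rw [hws]; abel, inner_neg_right, real_inner_smul_right,
      inner_sub_left]
    ring
  rw [← sub_add_sub_cancel v w z, norm_add_sq_real, hcross, lovasz_eq_inner hsub hempty huniv hs]
  linarith

theorem IsProxStationary.isProxSolution (hsub : IsSubmodular F) (hempty : F ∅ = 0)
    (huniv : F Finset.univ = 0) (hlam : 0 ≤ lam) (hw : IsProxStationary F z lam w) :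
    IsProxSolution F z lam w := fun v =>
  (le_add_of_nonneg_right (by positivity)).trans (hw.add_norm_sq_le hsub hempty huniv hlam v)

theorem IsProxStationary.eq_of_isProxSolution (hsub : IsSubmodular F) (hempty : F ∅ = 0)
    (huniv : F Finset.univ = 0) (hlam : 0 ≤ lam) (hw : IsProxStationary F z lam w)
    (hv : IsProxSolution F z lam v) : v = w := by
  have hgrowth := hw.add_norm_sq_le hsub hempty huniv hlam v
  have hsq : ‖v - w‖ ^ 2 = 0 := le_antisymm (by linarith [hv w]) (by positivity)
  exact sub_eq_zero.1 (norm_eq_zero.1 (pow_eq_zero_iff two_ne_zero |>.1 hsq))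

theorem IsProxSolution.isProxStationary (hsub : IsSubmodular F) (hempty : F ∅ = 0)
    (huniv : F Finset.univ = 0) (hlam : 0 ≤ lam) (hv : IsProxSolution F z lam v) :
    IsProxStationary F z lam v := by
  obtain ⟨w, hw⟩ := exists_isProxStationary hsub hempty z hlam
  exact hw.eq_of_isProxSolution hsub hempty huniv hlam hv ▸ hw

theorem existsUnique_isProxSolution (hsub : IsSubmodular F) (hempty : F ∅ = 0)
    (huniv : F Finset.univ = 0) (z : EuclideanSpace ℝ (Fin p)) (hlam : 0 ≤ lam) :
    ∃! w, IsProxSolution F z lam w := by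
  obtain ⟨w, hw⟩ := exists_isProxStationary hsub hempty z hlam
  exact ⟨w, hw.isProxSolution hsub hempty huniv hlam,
    fun v hv => hw.eq_of_isProxSolution hsub hempty huniv hlam hv⟩

end Prox

section AssocLattice

variable {p : ℕ} {F : Finset (Fin p) → ℝ} {w s : EuclideanSpace ℝ (Fin p)}
  {M N A B : Finset (Fin p)} {i j : Fin p}

theorem IsSuperlevelSet.mem_assocLattice (hsub : IsSubmodular F) (hempty : F ∅ = 0)
    (hA : IsSuperlevelSet w A) : A ∈ assocLattice F w := fun _ hs =>
  ((mem_exposedFace_iff_sum_eq hsub hempty).1 hs).2 A hA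

theorem empty_mem_assocLattice (hempty : F ∅ = 0) : ∅ ∈ assocLattice F w := fun _ _ => by
  simp [hempty]

theorem univ_mem_assocLattice : Finset.univ ∈ assocLattice F w := fun _ hs => hs.1.2

theorem union_inter_mem_assocLattice (hsub : IsSubmodular F) (hA : A ∈ assocLattice F w)
    (hB : B ∈ assocLattice F w) : A ∪ B ∈ assocLattice F w ∧ A ∩ B ∈ assocLattice F w := by
  refine forall₂_and.1 fun s hs => ?_
  have hmodular := Finset.sum_union_inter (s₁ := A) (s₂ := B) (f := s)
  have hunion := hs.1.1 (A ∪ B)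
  have hinter := hs.1.1 (A ∩ B)
  constructor <;> linarith [hA s hs, hB s hs, hsub A B]

theorem sum_sdiff_of_mem_assocLattice (hM : M ∈ assocLattice F w) (hN : N ∈ assocLattice F w)
    (hNM : N ⊆ M) (hs : s ∈ exposedFace F w) : ∑ k ∈ M \ N, s k = F M - F N := by
  rw [← hM s hs, ← hN s hs, ← Finset.sum_sdiff hNM, add_sub_cancel_right]

theorem SameConstantSet.mono {v : EuclideanSpace ℝ (Fin p)} (h : SameConstantSet F w i j)
    (hwv : exposedFace F w ⊆ exposedFace F v) : SameConstantSet F v i j := fun A hA =>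
  h A fun s hs => hA s (hwv hs)

theorem SameConstantSet.apply_eq (hsub : IsSubmodular F) (hempty : F ∅ = 0)
    (h : SameConstantSet F w i j) : w i = w j := by
  have hlevel : ∀ k l, k ∈ levelSet w (w l) ↔ w l ≤ w k := by simp [levelSet]
  have hmem : ∀ k, levelSet w (w k) ∈ assocLattice F w := fun k =>
    (isSuperlevelSet_levelSet w _).mem_assocLattice hsub hempty
  have hij := h _ (hmem i)
  have hji := h _ (hmem j)
  simp only [hlevel, le_rfl, true_iff, iff_true] at hij hji
  exact le_antisymm hij hji

open Classical in
/-- The constant set of `w` containing `i`. -/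
noncomputable def constantSet (F : Finset (Fin p) → ℝ) (w : EuclideanSpace ℝ (Fin p))
    (i : Fin p) : Finset (Fin p) :=
  Finset.univ.filter (SameConstantSet F w i)

theorem mem_constantSet : j ∈ constantSet F w i ↔ SameConstantSet F w i j := by
  simp [constantSet]

theorem SameConstantSet.constantSet_eq (h : SameConstantSet F w i j) :
    constantSet F w i = constantSet F w j := by
  ext k
  simp only [mem_constantSet]
  exact forall₂_congr fun A hA => by rw [h A hA]

theorem exists_ssubset_constantSet_eq_sdiff (hsub : IsSubmodular F) (hempty : F ∅ = 0)
    (hM : M ∈ assocLattice F w) (hne : M.Nonempty) :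
    ∃ N ∈ assocLattice F w, N ⊂ M ∧ ∀ i ∈ M \ N, constantSet F w i = M \ N := by
  obtain ⟨N, ⟨hN, hNM⟩, hmax⟩ := (toFinite {N | N ∈ assocLattice F w ∧ N ⊂ M}).exists_maximal
    ⟨∅, empty_mem_assocLattice hempty, Finset.empty_ssubset.2 hne⟩
  refine ⟨N, hN, hNM, fun i hi => ?_⟩
  have hcut : ∀ A ∈ assocLattice F w, N ∪ A ∩ M = M ∨ N ∪ A ∩ M = N := fun A hA => by
    have hmem := (union_inter_mem_assocLattice hsub hN
      (union_inter_mem_assocLattice hsub hA hM).2).1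
    refine (Finset.union_subset hNM.1 Finset.inter_subset_right).eq_or_ssubset.imp_right fun h => ?_
    exact (hmax ⟨hmem, h⟩ Finset.subset_union_left).antisymm Finset.subset_union_left
  ext j
  rw [mem_constantSet]
  constructor
  · intro h
    rwa [Finset.mem_sdiff, ← h M hM, ← h N hN, ← Finset.mem_sdiff]
  · intro hj A hA
    have hcutA := hcut A hA
    grind

theorem assocLattice_induction (hsub : IsSubmodular F) (hempty : F ∅ = 0)
    {motive : Finset (Fin p) → Prop} (empty : motive ∅)
    (step : ∀ M N, M ∈ assocLattice F w → N ∈ assocLattice F w → N ⊂ M →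
      (∀ i ∈ M \ N, constantSet F w i = M \ N) → motive N → motive M)
    (hM : M ∈ assocLattice F w) : motive M := by
  induction M using Finset.strongInduction with
  | H M ih =>
    rcases M.eq_empty_or_nonempty with rfl | hne
    · exact empty
    obtain ⟨N, hN, hNM, hclass⟩ := exists_ssubset_constantSet_eq_sdiff hsub hempty hM hne
    exact step M N hM hN hNM hclass (ih N hNM hN)

theorem inner_eq_inner_of_mem_exposedFace (hsub : IsSubmodular F) (hempty : F ∅ = 0)
    {x t : EuclideanSpace ℝ (Fin p)} (hx : ∀ i j, SameConstantSet F w i j → x i = x j)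
    (hs : s ∈ exposedFace F w) (ht : t ∈ exposedFace F w) : inner ℝ x s = inner ℝ x t := by
  rw [inner_eq_sum_mul, inner_eq_sum_mul]
  refine assocLattice_induction hsub hempty (w := w)
    (motive := fun M => ∑ k ∈ M, x k * s k = ∑ k ∈ M, x k * t k) (by simp) ?_
    univ_mem_assocLattice
  intro M N hM hN hNM hclass ih
  obtain ⟨i, hi⟩ := Finset.sdiff_nonempty.2 hNM.2
  have hblock : ∀ y ∈ exposedFace F w, ∑ k ∈ M \ N, x k * y k = x i * (F M - F N) :=
    fun y hy => by
      rw [← sum_sdiff_of_mem_assocLattice hM hN hNM.1 hy, Finset.mul_sum]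
      exact Finset.sum_congr rfl fun k hk => by
        rw [hx i k (mem_constantSet.1 (hclass i hi ▸ hk))]
  rw [← Finset.sum_sdiff hNM.1, ← Finset.sum_sdiff hNM.1, ih, hblock s hs, hblock t ht]

-- A linear form `⟪v, ·⟫` constant on the face of `w` exposes all of it as soon as it exposes one
-- of its points.
theorem exposedFace_subset_of_sameConstantSet (hsub : IsSubmodular F) (hempty : F ∅ = 0)
    {v : EuclideanSpace ℝ (Fin p)} (hvw : exposedFace F v ⊆ exposedFace F w)
    (hv : ∀ i j, SameConstantSet F w i j → v i = v j) : exposedFace F w ⊆ exposedFace F v := by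
  intro s hs
  obtain ⟨g, hg⟩ := exposedFace_nonempty hsub hempty v
  rw [mem_exposedFace_iff_inner_le, inner_eq_inner_of_mem_exposedFace hsub hempty hv hs (hvw hg)]
  exact ⟨hs.1, (mem_exposedFace_iff_inner_le.1 hg).2⟩

theorem not_isSeparableSet_sdiff (hM : M ∈ assocLattice F w) (hN : N ∈ assocLattice F w)
    (hNM : N ⊆ M) (hclass : ∀ i ∈ M \ N, constantSet F w i = M \ N) :
    ¬ IsSeparableSet (contraction F N) (M \ N) := by
  rintro ⟨B, C, ⟨b, hb⟩, ⟨c, hc⟩, hBC, hunion, hsep⟩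
  have hbM : b ∈ M \ N := hunion ▸ Finset.mem_union_left _ hb
  have hcM : c ∈ M \ N := hunion ▸ Finset.mem_union_right _ hc
  have hNBC : Disjoint N (B ∪ C) := hunion ▸ Finset.disjoint_sdiff
  obtain ⟨hdB, hdC⟩ := Finset.disjoint_union_right.1 hNBC
  have hNB : N ∪ B ∈ assocLattice F w := by
    intro s hs
    have hsum := sum_sdiff_of_mem_assocLattice hM hN hNM hs
    have hleB := hs.1.1 (N ∪ B)
    have hleC := hs.1.1 (N ∪ C)
    rw [← hunion, Finset.sum_union hBC] at hsum
    simp only [contraction, Finset.union_sdiff_of_subset hNM] at hsep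
    rw [Finset.sum_union hdB, hN s hs] at hleB ⊢
    rw [Finset.sum_union hdC, hN s hs] at hleC
    linarith
  have hcNB : c ∈ N ∪ B :=
    (mem_constantSet.1 (hclass b hbM ▸ hcM) _ hNB).1 (Finset.mem_union_right _ hb)
  exact (Finset.mem_union.1 hcNB).elim (Finset.mem_sdiff.1 hcM).2
    (Finset.disjoint_right.1 hBC hc)

end AssocLattice

section ValueSet

variable {p : ℕ} {F : Finset (Fin p) → ℝ} {w : EuclideanSpace ℝ (Fin p)} {α : ℝ}
  {A C : Finset (Fin p)} {i j : Fin p}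

theorem strictLevelSet_union_valueSet (w : EuclideanSpace ℝ (Fin p)) (α : ℝ) :
    strictLevelSet w α ∪ valueSet w α = levelSet w α := by
  ext k
  simp [strictLevelSet, valueSet, levelSet, le_iff_lt_or_eq, eq_comm]

theorem disjoint_strictLevelSet_valueSet (w : EuclideanSpace ℝ (Fin p)) (α : ℝ) :
    Disjoint (strictLevelSet w α) (valueSet w α) :=
  Finset.disjoint_filter.2 fun _ _ hlt heq => hlt.ne' heq

-- Ties in `w` may be broken arbitrarily in the greedy algorithm, in particular in favour of `C`.
theorem exists_mem_exposedFace_sum_strictLevelSet_union_eq (hsub : IsSubmodular F)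
    (hempty : F ∅ = 0) (hC : C ⊆ valueSet w α) :
    ∃ s ∈ exposedFace F w, ∑ k ∈ strictLevelSet w α ∪ C, s k = F (strictLevelSet w α ∪ C) := by
  let q : Fin p → ℝ ×ₗ Bool := fun k => toLex (w k, decide (k ∈ C))
  obtain ⟨s, hs, hsq⟩ := exists_mem_basePolyhedron_sum_eq hsub hempty q
  refine ⟨s, (mem_exposedFace_iff_sum_eq hsub hempty).2 ⟨hs, fun U hU => hsq U
    (hU.of_le_imp_le fun i j hij => Prod.Lex.monotone_fst _ _ hij)⟩, hsq _ fun i j hij hi => ?_⟩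
  have hwC : ∀ k ∈ C, w k = α := fun k hk => by simpa [valueSet] using hC hk
  simp only [q, Prod.Lex.toLex_le_toLex, strictLevelSet, Finset.mem_union, Finset.mem_filter,
    Finset.mem_univ, true_and, Bool.le_iff_imp, decide_eq_true_eq] at hij hi ⊢
  grind

theorem contraction_valueSet_eq_add (hsub : IsSubmodular F) (hempty : F ∅ = 0)
    (hA : A ∈ assocLattice F w) (α : ℝ) :
    contraction F (strictLevelSet w α) (valueSet w α) =
      contraction F (strictLevelSet w α) (valueSet w α ∩ A) +
        contraction F (strictLevelSet w α) (valueSet w α \ A) := by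
  have hstrict := (isSuperlevelSet_strictLevelSet w α).mem_assocLattice hsub hempty
  have hlevel := (isSuperlevelSet_levelSet w α).mem_assocLattice hsub hempty
  have hunion := strictLevelSet_union_valueSet w α
  have hinter : strictLevelSet w α ∪ valueSet w α ∩ A ∈ assocLattice F w := by
    rw [Finset.union_inter_distrib_left, hunion]
    exact (union_inter_mem_assocLattice hsub hlevel
      (union_inter_mem_assocLattice hsub hstrict hA).1).2
  obtain ⟨s, hs, hsdiff⟩ :=
    exists_mem_exposedFace_sum_strictLevelSet_union_eq hsub hempty (w := w) (α := α)
      (C := valueSet w α \ A) Finset.sdiff_subset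
  have hsum : ∀ D ⊆ valueSet w α, ∑ k ∈ strictLevelSet w α ∪ D, s k = F (strictLevelSet w α ∪ D) →
      contraction F (strictLevelSet w α) D = ∑ k ∈ D, s k := fun D hD hDs => by
    rw [contraction, ← hDs, ← hstrict s hs,
      Finset.sum_union ((disjoint_strictLevelSet_valueSet w α).mono_right hD),
      add_sub_cancel_left]
  rw [hsum _ subset_rfl (hunion ▸ hlevel s hs), hsum _ Finset.inter_subset_left (hinter s hs),
    hsum _ Finset.sdiff_subset hsdiff, Finset.sum_inter_add_sum_sdiff]

theorem sameConstantSet_of_not_isSeparableSet (hsub : IsSubmodular F) (hempty : F ∅ = 0)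
    (hinsep : ¬ IsSeparableSet (contraction F (strictLevelSet w α)) (valueSet w α))
    (hi : i ∈ valueSet w α) (hj : j ∈ valueSet w α) : SameConstantSet F w i j := by
  intro A hA
  have huncut : valueSet w α ∩ A = ∅ ∨ valueSet w α \ A = ∅ := by
    by_contra! hne
    exact hinsep ⟨_, _, hne.1, hne.2, Finset.disjoint_sdiff_inter _ _ |>.symm,
      by rw [Finset.union_comm, Finset.sdiff_union_inter],
      contraction_valueSet_eq_add hsub hempty hA α⟩
  rcases huncut with h | h
  · exact iff_of_false (fun hiA => by simpa [h] using Finset.mem_inter.2 ⟨hi, hiA⟩)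
      (fun hjA => by simpa [h] using Finset.mem_inter.2 ⟨hj, hjA⟩)
  · exact iff_of_true (Finset.sdiff_eq_empty_iff_subset.1 h hi)
      (Finset.sdiff_eq_empty_iff_subset.1 h hj)

end ValueSet

section Agglomerative

variable {p : ℕ} {F : Finset (Fin p) → ℝ} {w s : EuclideanSpace ℝ (Fin p)}
  {M N A C : Finset (Fin p)} {i j : Fin p}

/-- The condition on `F` under which the regularization path is agglomerative: for every
contraction `G` of `F` and every set `A` inseparable for `G`, the uniform vector of total mass
`G A` on `A` satisfies the constraints `s(C) ≤ G(C)` for `C ⊆ A`. -/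
def IsAgglomerative (F : Finset (Fin p) → ℝ) : Prop :=
  ∀ A B : Finset (Fin p), Disjoint A B → ¬ IsSeparableSet (contraction F B) A →
    ∀ C ⊆ A, (C.card : ℝ) / (A.card : ℝ) * (F (B ∪ A) - F B) ≤ F (B ∪ C) - F B

/-- The vector obtained from `s` by averaging over each constant set of `w`. -/
noncomputable def constantSetAverage (F : Finset (Fin p) → ℝ) (w s : EuclideanSpace ℝ (Fin p)) :
    EuclideanSpace ℝ (Fin p) :=
  WithLp.toLp 2 fun k => (∑ j ∈ constantSet F w k, s j) / ((constantSet F w k).card : ℝ)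

theorem SameConstantSet.constantSetAverage_eq (h : SameConstantSet F w i j)
    (s : EuclideanSpace ℝ (Fin p)) : constantSetAverage F w s i = constantSetAverage F w s j := by
  simp only [constantSetAverage, h.constantSet_eq]

theorem sum_constantSetAverage_of_subset_sdiff (hM : M ∈ assocLattice F w)
    (hN : N ∈ assocLattice F w) (hNM : N ⊆ M) (hclass : ∀ i ∈ M \ N, constantSet F w i = M \ N)
    (hs : s ∈ exposedFace F w) (hC : C ⊆ M \ N) :
    ∑ k ∈ C, constantSetAverage F w s k =
      (C.card : ℝ) / ((M \ N).card : ℝ) * (F M - F N) := by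
  have hvalue : ∀ k ∈ C, constantSetAverage F w s k = (F M - F N) / ((M \ N).card : ℝ) :=
    fun k hk => by
      simp only [constantSetAverage, hclass k (hC hk),
        sum_sdiff_of_mem_assocLattice hM hN hNM hs]
  rw [Finset.sum_congr rfl hvalue, Finset.sum_const, nsmul_eq_mul]
  ring

theorem sum_constantSetAverage_of_mem_assocLattice (hsub : IsSubmodular F) (hempty : F ∅ = 0)
    (hs : s ∈ exposedFace F w) (hM : M ∈ assocLattice F w) :
    ∑ k ∈ M, constantSetAverage F w s k = F M := by
  refine assocLattice_induction hsub hempty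
    (motive := fun M => ∑ k ∈ M, constantSetAverage F w s k = F M) (by simp [hempty])
    (fun M N hM hN hNM hclass ih => ?_) hM
  have hcard : ((M \ N).card : ℝ) ≠ 0 :=
    Nat.cast_ne_zero.2 (Finset.card_ne_zero.2 (Finset.sdiff_nonempty.2 hNM.2))
  rw [← Finset.sum_sdiff hNM.1, ih,
    sum_constantSetAverage_of_subset_sdiff hM hN hNM.1 hclass hs subset_rfl, div_self hcard,
    one_mul, sub_add_cancel]

theorem sum_constantSetAverage_le (hsub : IsSubmodular F) (hempty : F ∅ = 0)
    (hagglo : IsAgglomerative F) (hs : s ∈ exposedFace F w) (hM : M ∈ assocLattice F w)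
    (hA : A ⊆ M) : ∑ k ∈ A, constantSetAverage F w s k ≤ F A := by
  revert A
  refine assocLattice_induction hsub hempty
    (motive := fun M => ∀ {A}, A ⊆ M → ∑ k ∈ A, constantSetAverage F w s k ≤ F A)
    (fun {A} hA => by simp [Finset.subset_empty.1 hA, hempty])
    (fun M N hM hN hNM hclass ih {A} hA => ?_) hM
  have hC : A \ N ⊆ M \ N := Finset.sdiff_subset_sdiff hA subset_rfl
  have hblock : ∑ k ∈ A \ N, constantSetAverage F w s k ≤ F (A ∪ N) - F N := calc
    _ = ((A \ N).card : ℝ) / ((M \ N).card : ℝ) * (F (N ∪ M \ N) - F N) := by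
      rw [sum_constantSetAverage_of_subset_sdiff hM hN hNM.1 hclass hs hC,
        Finset.union_sdiff_of_subset hNM.1]
    _ ≤ F (N ∪ A \ N) - F N := hagglo _ _ Finset.sdiff_disjoint
      (not_isSeparableSet_sdiff hM hN hNM.1 hclass) _ hC
    _ = F (A ∪ N) - F N := by rw [Finset.union_sdiff_self_eq_union, Finset.union_comm]
  rw [← Finset.sum_inter_add_sum_sdiff A N]
  linarith [hsub A N, ih (A := A ∩ N) Finset.inter_subset_right]

theorem constantSetAverage_mem_exposedFace (hsub : IsSubmodular F) (hempty : F ∅ = 0)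
    (hagglo : IsAgglomerative F) (hs : s ∈ exposedFace F w) :
    constantSetAverage F w s ∈ exposedFace F w := by
  have hsum : ∀ M ∈ assocLattice F w, ∑ k ∈ M, constantSetAverage F w s k = F M := fun M =>
    sum_constantSetAverage_of_mem_assocLattice hsub hempty hs
  exact (mem_exposedFace_iff_sum_eq hsub hempty).2
    ⟨⟨fun A => sum_constantSetAverage_le hsub hempty hagglo hs univ_mem_assocLattice
        (Finset.subset_univ A), hsum _ univ_mem_assocLattice⟩,
      fun U hU => hsum U (hU.mem_assocLattice hsub hempty)⟩

theorem eventually_exists_isProxStationary_exposedFace_subset (hsub : IsSubmodular F)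
    (hempty : F ∅ = 0) (hagglo : IsAgglomerative F) (w : EuclideanSpace ℝ (Fin p)) :
    ∀ᶠ t in 𝓝 (0 : ℝ), ∃ v, IsProxStationary F w t v ∧ exposedFace F w ⊆ exposedFace F v := by
  obtain ⟨s, hs⟩ := exposedFace_nonempty hsub hempty w
  have hx := constantSetAverage_mem_exposedFace hsub hempty hagglo hs
  set x := constantSetAverage F w s with hxdef
  have hline : Tendsto (fun t : ℝ => w - t • x) (𝓝 0) (𝓝 w) := by
    have hcont : Continuous fun t : ℝ => w - t • x := by fun_prop
    simpa using hcont.tendsto 0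
  filter_upwards [hline.eventually (eventually_exposedFace_subset hsub hempty w)] with t ht
  have hface := exposedFace_subset_of_sameConstantSet hsub hempty ht fun i j hij => by
    simp [hij.apply_eq hsub hempty, hxdef, hij.constantSetAverage_eq s]
  exact ⟨w - t • x, ⟨x, hface hx, rfl⟩, hface⟩

-- The parameters `l` at which the face still contains `exposedFace F u` form a closed set by
-- continuity of the path, and an open set to the right by the preceding lemma.
theorem exposedFace_subset_of_isProxStationary (hsub : IsSubmodular F) (hempty : F ∅ = 0)
    (hagglo : IsAgglomerative F) {z u v : EuclideanSpace ℝ (Fin p)} {mu lam : ℝ} (hmu : 0 ≤ mu)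
    (hle : mu ≤ lam) (hu : IsProxStationary F z mu u) (hv : IsProxStationary F z lam v) :
    exposedFace F u ⊆ exposedFace F v := by
  choose! x hx using fun l (hl : 0 ≤ l) => exists_isProxStationary hsub hempty z hl
  set S := x ⁻¹' {y | exposedFace F u ⊆ exposedFace F y} with hS
  have hclosed : IsClosed (S ∩ Icc mu lam) := by
    rw [inter_comm]
    exact ((continuousOn_of_isProxStationary hx).mono fun l hl => hmu.trans hl.1)
      |>.preimage_isClosed_of_isClosed isClosed_Icc (isClosed_setOf_subset_exposedFace F _)
  have hstart : mu ∈ S := by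
    rw [hS, mem_preimage, (hx mu hmu).unique hmu hu]
    exact Subset.rfl
  have hright : ∀ l ∈ S ∩ Ico mu lam, S ∈ 𝓝[>] l := by
    rintro l ⟨hl, hmul, -⟩
    have hl0 := hmu.trans hmul
    have hshift : Tendsto (fun l' => l' - l) (𝓝[>] l) (𝓝 0) := by
      have hcont : Continuous fun l' : ℝ => l' - l := by fun_prop
      simpa using (hcont.tendsto l).mono_left nhdsWithin_le_nhds
    filter_upwards [self_mem_nhdsWithin, hshift.eventually
      (eventually_exists_isProxStationary_exposedFace_subset hsub hempty hagglo (x l))]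
      with l' hl' ⟨y, hy, hxy⟩
    have hl'0 := hl0.trans (le_of_lt hl')
    have hyz := (hx l hl0).trans hl0 (sub_nonneg.2 (le_of_lt hl')) hy hxy
    rw [add_sub_cancel] at hyz
    rw [hS, mem_preimage, (hx l' hl'0).unique hl'0 hyz]
    exact hl.trans hxy
  have hlam := hmu.trans hle
  rw [hv.unique hlam (hx lam hlam)]
  exact hclosed.Icc_subset_of_forall_mem_nhdsWithin hstart hright (right_mem_Icc.2 hle)

end Agglomerative

theorem proposition4_general {p : ℕ} (F : Finset (Fin p) → ℝ)
    (hsub : IsSubmodular F) (hempty : F ∅ = 0) (huniv : F Finset.univ = 0)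
    (hagglo : IsAgglomerative F) (z : EuclideanSpace ℝ (Fin p)) :
    (∀ lam : ℝ, 0 ≤ lam → ∃! w, IsProxSolution F z lam w) ∧
    ∀ mu lam : ℝ, 0 ≤ mu → mu ≤ lam →
      ∀ u v : EuclideanSpace ℝ (Fin p), IsProxSolution F z mu u → IsProxSolution F z lam v →
        (∀ i j : Fin p, SameConstantSet F u i j → SameConstantSet F v i j ∧ v i = v j) ∧
        (∀ α : ℝ, ¬ IsSeparableSet (contraction F (strictLevelSet u α)) (valueSet u α) →
          ∀ i ∈ valueSet u α, ∀ j ∈ valueSet u α, SameConstantSet F v i j ∧ v i = v j) := by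
  refine ⟨fun lam hlam => existsUnique_isProxSolution hsub hempty huniv z hlam,
    fun mu lam hmu hle u v hu hv => ?_⟩
  have hface : exposedFace F u ⊆ exposedFace F v :=
    exposedFace_subset_of_isProxStationary hsub hempty hagglo hmu hle
      (hu.isProxStationary hsub hempty huniv hmu)
      (hv.isProxStationary hsub hempty huniv (hmu.trans hle))
  have hsame : ∀ i j, SameConstantSet F u i j → SameConstantSet F v i j ∧ v i = v j :=
    fun i j hij => ⟨hij.mono hface, (hij.mono hface).apply_eq hsub hempty⟩
  exact ⟨hsame, fun α hinsep i hi j hj =>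
    hsame i j (sameConstantSet_of_not_isSeparableSet hsub hempty hinsep hi hj)⟩

theorem proposition4 {p : ℕ} (F : Finset (Fin p) → ℝ)
    (hsub : IsSubmodular F) (hnonneg : ∀ A, 0 ≤ F A)
    (hempty : F ∅ = 0) (huniv : F Finset.univ = 0)
    (hagglo : ∀ A B : Finset (Fin p), Disjoint A B → ¬ IsSeparableSet (contraction F B) A →
      ∀ C ⊆ A, (C.card : ℝ) / (A.card : ℝ) * (F (B ∪ A) - F B) ≤ F (B ∪ C) - F B)
    (z : EuclideanSpace ℝ (Fin p)) :
    (∀ lam : ℝ, 0 ≤ lam → ∃! w, IsProxSolution F z lam w) ∧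
    ∀ mu lam : ℝ, 0 ≤ mu → mu ≤ lam →
      ∀ u v : EuclideanSpace ℝ (Fin p), IsProxSolution F z mu u → IsProxSolution F z lam v →
        (∀ i j : Fin p, SameConstantSet F u i j → SameConstantSet F v i j ∧ v i = v j) ∧
        (∀ α : ℝ, ¬ IsSeparableSet (contraction F (strictLevelSet u α)) (valueSet u α) →
          ∀ i ∈ valueSet u α, ∀ j ∈ valueSet u α, SameConstantSet F v i j ∧ v i = v j) :=
  proposition4_general F hsub hempty huniv hagglo z
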